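/- Let $L$ be a finite-dimensional Lie algebra over a field $\mathbb F$ (of arbitrary characteristic), let $M$ be an abelian ideal of $L$, let $C_L(M)=\{l\in L : [l,m]=0 \text{ for all } m\in M\}$ be its centralizer, and let $x\in L$ be such that $L=C_L(M)\rtimes\langle x\rangle$, that is, $L=C_L(M)\oplus \mathbb F x$ as vector spaces. Let $U(L)$ be the universal enveloping algebra of $L$ and let $\omega(L)$ be its augmentation ideal, i.e. the kernel of the algebra homomorphism $U(L)\to\mathbb F$ that maps $L$ to $0$. Let $MU(L)$ and $M\omega(L)$ be the linear spans in $U(L)$ of the products $mu$ with $m\in M$ and $u\in U(L)$, respectively $u\in\omega(L)$; both are two-sided ideals of $U(L)$. Put $$J=\{w\in U(L) : wa-aw\in M\omega(L)\text{ for all } a\in MU(L)\},\qquad \mathfrak J=J\cap\omega(L).$$ Then $\mathfrak J$ is a two-sided ideal of $U(L)$; define the associative algebra $U_M=U(L)/\mathfrak J$. Then, up to a nonzero scalar factor, there is exactly one polynomial $f\in\mathbb F[X]$ that has smallest degree among the nonzero polynomials satisfying $f(0)=0$ and $f((\operatorname{ad}x)|_M)=0$. For each such $f$ there is an isomorphism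 of $\mathbb F$-algebras $$U_M\cong\mathbb F[X]/(f)$$ that maps the class of $x$ to the class of $X$. -/

import Mathlib

namespace EnvelopingInvariant

open Polynomial

universe u v

attribute [local instance] LieRing.ofAssociativeRing

variable (F : Type u) {L : Type v} [Field F] [LieRing L] [LieAlgebra F L]

/-- The augmentation map `ε_L : U(L) → F`, the algebra homomorphism that kills `L`. -/
noncomputable def augmentation : UniversalEnvelopingAlgebra F L →ₐ[F] F :=
  UniversalEnvelopingAlgebra.lift F (0 : L →ₗ⁅F⁆ F)

variable (L) in
/-- The augmentation ideal `ω(L)` of `U(L)`, as a linear subspace of `U(L)`. -/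
noncomputable def augIdeal : Submodule F (UniversalEnvelopingAlgebra F L) :=
  LinearMap.ker (augmentation F (L := L)).toLinearMap

variable {F}

/-- The image of a Lie ideal `M` of `L` in `U(L)`. -/
noncomputable def image (M : LieIdeal F L) : Submodule F (UniversalEnvelopingAlgebra F L) :=
  M.toSubmodule.map (UniversalEnvelopingAlgebra.ι F : L →ₗ⁅F⁆ _).toLinearMap

/-- `M U(L)`: the linear span of the products `m * u` with `m ∈ M` and `u ∈ U(L)`. -/
noncomputable def MU (M : LieIdeal F L) : Submodule F (UniversalEnvelopingAlgebra F L) :=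
  image M * ⊤

/-- `M ω(L)`: the linear span of the products `m * u` with `m ∈ M` and `u ∈ ω(L)`. -/
noncomputable def Mω (M : LieIdeal F L) : Submodule F (UniversalEnvelopingAlgebra F L) :=
  image M * augIdeal F L

/-- The subspace `J` of `U(L)`: the elements `w` that act trivially by `a ↦ w a - a w` on
`M U(L) / M ω(L)`. -/
noncomputable def J (M : LieIdeal F L) : Submodule F (UniversalEnvelopingAlgebra F L) where
  carrier := {w | ∀ a ∈ MU M, w * a - a * w ∈ Mω M}
  zero_mem' := by
    intro a _
    simp
  add_mem' := by
    intro w v hw hv a ha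
    have h := (Mω M).add_mem (hw a ha) (hv a ha)
    rwa [show w * a - a * w + (v * a - a * v) = (w + v) * a - a * (w + v) by noncomm_ring] at h
  smul_mem' := by
    intro c w hw a ha
    have h := (Mω M).smul_mem c (hw a ha)
    rwa [smul_sub, ← smul_mul_assoc, ← mul_smul_comm] at h

/-- The centralizer `C_L(M)` of a Lie ideal `M` in `L`. -/
def centralizer (M : LieIdeal F L) : LieIdeal F L := LieModule.ker F L M

theorem mem_centralizer (M : LieIdeal F L) (x : L) :
    x ∈ centralizer M ↔ ∀ m ∈ M, ⁅x, m⁆ = 0 := by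
  rw [centralizer, LieModule.mem_ker]
  constructor
  · intro h m hm
    simpa using congrArg Subtype.val (h ⟨m, hm⟩)
  · rintro h ⟨m, hm⟩
    exact Subtype.ext (by simpa using h m hm)

theorem mem_augIdeal (w : UniversalEnvelopingAlgebra F L) :
    w ∈ augIdeal F L ↔ augmentation F w = 0 := Iff.rfl

theorem mul_mem_augIdeal_left (u : UniversalEnvelopingAlgebra F L)
    {w : UniversalEnvelopingAlgebra F L} (hw : w ∈ augIdeal F L) : u * w ∈ augIdeal F L := by
  rw [mem_augIdeal] at *
  simp [hw]

theorem mul_mem_augIdeal_right (u : UniversalEnvelopingAlgebra F L)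
    {w : UniversalEnvelopingAlgebra F L} (hw : w ∈ augIdeal F L) : w * u ∈ augIdeal F L := by
  rw [mem_augIdeal] at *
  simp [hw]

/-- `U(L)` is generated by `L` as an associative algebra. -/
theorem adjoin_range_ι :
    Algebra.adjoin F (Set.range (UniversalEnvelopingAlgebra.ι F : L → _)) =
      (⊤ : Subalgebra F (UniversalEnvelopingAlgebra F L)) := by
  set S := Algebra.adjoin F (Set.range (UniversalEnvelopingAlgebra.ι F : L → _)) with hS
  let g : L →ₗ⁅F⁆ S :=
    { toFun := fun x => ⟨UniversalEnvelopingAlgebra.ι F x, Algebra.subset_adjoin ⟨x, rfl⟩⟩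
      map_add' := fun x y => Subtype.ext (map_add _ x y)
      map_smul' := fun c x => Subtype.ext (map_smul _ c x)
      map_lie' := by
        intro x y
        exact Subtype.ext (LieHom.map_lie _ x y) }
  have h : S.val.comp (UniversalEnvelopingAlgebra.lift F g) = AlgHom.id F _ := by
    apply UniversalEnvelopingAlgebra.hom_ext
    ext x
    change ((UniversalEnvelopingAlgebra.lift F g (UniversalEnvelopingAlgebra.ι F x) : S) :
      UniversalEnvelopingAlgebra F L) = UniversalEnvelopingAlgebra.ι F x
    rw [UniversalEnvelopingAlgebra.lift_ι_apply]
    rfl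
  rw [eq_top_iff]
  intro w _
  have hw := DFunLike.congr_fun h w
  rw [AlgHom.id_apply] at hw
  rw [← hw]
  exact (UniversalEnvelopingAlgebra.lift F g w).2

/-- `P` is stable under left multiplication by `U(L)` as soon as it is under that by `L`. -/
theorem mul_mem_of_ι_mul_mem (P : Submodule F (UniversalEnvelopingAlgebra F L))
    (h : ∀ (x : L), ∀ a ∈ P, UniversalEnvelopingAlgebra.ι F x * a ∈ P)
    (u : UniversalEnvelopingAlgebra F L) : ∀ a ∈ P, u * a ∈ P := by
  have hu : u ∈ Algebra.adjoin F (Set.range (UniversalEnvelopingAlgebra.ι F : L → _)) := by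
    rw [adjoin_range_ι]; trivial
  induction hu using Algebra.adjoin_induction with
  | mem y hy =>
    obtain ⟨x, rfl⟩ := hy
    exact h x
  | algebraMap r =>
    intro a ha
    rw [← Algebra.smul_def]
    exact P.smul_mem r ha
  | add y z _ _ hy hz =>
    intro a ha
    rw [add_mul]
    exact P.add_mem (hy a ha) (hz a ha)
  | mul y z _ _ hy hz =>
    intro a ha
    rw [mul_assoc]
    exact hy _ (hz a ha)

/-- `M V` is stable under left multiplication if the subspace `V` of `U(L)` is. -/
theorem mul_mem_image_mul (M : LieIdeal F L) (V : Submodule F (UniversalEnvelopingAlgebra F L))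
    (hV : ∀ u, ∀ v ∈ V, u * v ∈ V) (u : UniversalEnvelopingAlgebra F L) :
    ∀ a ∈ image M * V, u * a ∈ image M * V := by
  refine mul_mem_of_ι_mul_mem _ ?_ u
  intro x a ha
  induction ha using Submodule.mul_induction_on' with
  | mem_mul_mem m hm v hv =>
    obtain ⟨m, hm, rfl⟩ := hm
    have e : UniversalEnvelopingAlgebra.ι F x * (UniversalEnvelopingAlgebra.ι F m * v) =
        UniversalEnvelopingAlgebra.ι F ⁅x, m⁆ * v +
          UniversalEnvelopingAlgebra.ι F m * (UniversalEnvelopingAlgebra.ι F x * v) := by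
      rw [LieHom.map_lie, LieRing.of_associative_ring_bracket]
      noncomm_ring
    refine e ▸ Submodule.add_mem _ (Submodule.mul_mem_mul ⟨_, lie_mem_right F L M x m hm, rfl⟩ hv)
      (Submodule.mul_mem_mul ⟨m, hm, rfl⟩ (hV _ _ hv))
  | add a _ b _ ha hb =>
    rw [mul_add]
    exact Submodule.add_mem _ ha hb

theorem image_mul_mul_mem (M : LieIdeal F L) (V : Submodule F (UniversalEnvelopingAlgebra F L))
    (hV : ∀ u, ∀ v ∈ V, v * u ∈ V) (u : UniversalEnvelopingAlgebra F L) :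
    ∀ a ∈ image M * V, a * u ∈ image M * V := by
  intro a ha
  induction ha using Submodule.mul_induction_on' with
  | mem_mul_mem m hm v hv =>
    rw [mul_assoc]
    exact Submodule.mul_mem_mul hm (hV _ _ hv)
  | add a _ b _ ha hb =>
    rw [add_mul]
    exact Submodule.add_mem _ ha hb

theorem mul_mem_MU (M : LieIdeal F L) (u : UniversalEnvelopingAlgebra F L)
    {a : UniversalEnvelopingAlgebra F L} (ha : a ∈ MU M) : u * a ∈ MU M :=
  mul_mem_image_mul M ⊤ (fun _ _ _ => trivial) u a ha

theorem MU_mul_mem (M : LieIdeal F L) (u : UniversalEnvelopingAlgebra F L)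
    {a : UniversalEnvelopingAlgebra F L} (ha : a ∈ MU M) : a * u ∈ MU M :=
  image_mul_mul_mem M ⊤ (fun _ _ _ => trivial) u a ha

theorem mul_mem_Mω (M : LieIdeal F L) (u : UniversalEnvelopingAlgebra F L)
    {a : UniversalEnvelopingAlgebra F L} (ha : a ∈ Mω M) : u * a ∈ Mω M :=
  mul_mem_image_mul M _ (fun u _ hv => mul_mem_augIdeal_left u hv) u a ha

theorem Mω_mul_mem (M : LieIdeal F L) (u : UniversalEnvelopingAlgebra F L)
    {a : UniversalEnvelopingAlgebra F L} (ha : a ∈ Mω M) : a * u ∈ Mω M :=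
  image_mul_mul_mem M _ (fun u _ hv => mul_mem_augIdeal_right u hv) u a ha

theorem MU_mul_aug_mem (M : LieIdeal F L) {a w : UniversalEnvelopingAlgebra F L}
    (ha : a ∈ MU M) (hw : w ∈ augIdeal F L) : a * w ∈ Mω M := by
  have h : a * w ∈ image M * ⊤ * augIdeal F L := Submodule.mul_mem_mul ha hw
  rw [mul_assoc] at h
  have hle : (⊤ : Submodule F (UniversalEnvelopingAlgebra F L)) * augIdeal F L ≤ augIdeal F L :=
    Submodule.mul_le.2 fun u _ v hv => mul_mem_augIdeal_left u hv
  exact Submodule.mul_le.2 (fun m hm v hv => Submodule.mul_mem_mul hm (hle hv)) h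

theorem sub_mem_MU (M : LieIdeal F L) (u : UniversalEnvelopingAlgebra F L)
    {a : UniversalEnvelopingAlgebra F L} (ha : a ∈ MU M) : u * a - a * u ∈ MU M :=
  (MU M).sub_mem (mul_mem_MU M u ha) (MU_mul_mem M u ha)

/-- The ideal `𝔍 = J ∩ ω(L)` of `U(L)`. -/
noncomputable def frakJ (M : LieIdeal F L) : Ideal (UniversalEnvelopingAlgebra F L) where
  carrier := {w | w ∈ J M ∧ w ∈ augIdeal F L}
  zero_mem' := ⟨(J M).zero_mem, (augIdeal F L).zero_mem⟩
  add_mem' := fun hw hv => ⟨(J M).add_mem hw.1 hv.1, (augIdeal F L).add_mem hw.2 hv.2⟩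
  smul_mem' := by
    rintro u w ⟨hw, hw'⟩
    refine ⟨fun a ha => ?_, mul_mem_augIdeal_left u hw'⟩
    have h := (Mω M).add_mem (mul_mem_Mω M u (hw a ha))
      (MU_mul_aug_mem M (sub_mem_MU M u ha) hw')
    rwa [show u * (w * a - a * w) + (u * a - a * u) * w = u • w * a - a * u • w by
      simp only [smul_eq_mul]; noncomm_ring] at h

theorem mem_frakJ (M : LieIdeal F L) (w : UniversalEnvelopingAlgebra F L) :
    w ∈ frakJ M ↔ w ∈ J M ∧ w ∈ augIdeal F L := Iff.rfl

/-- `𝔍` is a two-sided ideal. -/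
instance (M : LieIdeal F L) : (frakJ M).IsTwoSided where
  mul_mem_of_left := by
    rintro w u ⟨hw, hw'⟩
    refine ⟨fun a ha => ?_, mul_mem_augIdeal_right u hw'⟩
    have h := (Mω M).add_mem ((Mω M).add_mem (Mω_mul_mem M u (hw a ha))
      (hw _ (sub_mem_MU M u ha))) (MU_mul_aug_mem M (sub_mem_MU M u ha) hw')
    rwa [show (w * a - a * w) * u + (w * (u * a - a * u) - (u * a - a * u) * w)
      + (u * a - a * u) * w = w * u * a - a * (w * u) by noncomm_ring] at h

/-- The associative algebra `U_M = U(L) / 𝔍`. -/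
abbrev assocU (M : LieIdeal F L) : Type _ := UniversalEnvelopingAlgebra F L ⧸ frakJ M

/-- The image in `U_M` of an element of `L`. -/
noncomputable def toAssocU (M : LieIdeal F L) (x : L) : assocU M :=
  Ideal.Quotient.mk (frakJ M) (UniversalEnvelopingAlgebra.ι F x)

/-- `f` is a nonzero polynomial with `f(0) = 0` and `f(φ) = 0`, and it has the smallest degree
among all such polynomials. -/
def IsSmallestDegree {V : Type*} [AddCommGroup V] [Module F V] (φ : Module.End F V)
    (f : F[X]) : Prop :=
  f ≠ 0 ∧ f.eval 0 = 0 ∧ aeval φ f = 0 ∧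
    ∀ g : F[X], g ≠ 0 → g.eval 0 = 0 → aeval φ g = 0 → f.natDegree ≤ g.natDegree

end EnvelopingInvariant

/-! For `w` in `ω(L)` and `a` in `M U(L)` the product `a w` already lies in `M ω(L)`, so `w ∈ J`
only asks that `w a ∈ M ω(L)`. Modulo `M ω(L)`, `w m` is the adjoint action of `w` on `m ∈ M`
(`mul_ι_sub_mem_Mω`). As `M` embeds in `U(L) / M ω(L)` (`eq_zero_of_ι_mem_Mω`), `𝔍` is the common
kernel of the augmentation and of `adRep M` (`mem_frakJ_iff`). Hence `C_L(M)` dies in `U_M`, the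
class of `x` generates, and `p(x) = 0` in `U_M` means `p(0) = 0` and `p(ad x) = 0` on `M`. These `p`
form an ideal of `F[X]`, generated by `f`.

The embedding carries the weight. It rests on the Poincaré–Birkhoff–Witt representation of `L` on
ordered monomials (`monomialRep`). For a basis beginning with one of `M`, elements of `M` act as
multiplication and `ω(L)` removes constant terms, so `M ω(L)` sends `1` into degree at least 2,
while `m ∈ M` sends `1` to a vector with linear part `m`. -/

namespace EnvelopingInvariant

open Polynomial

attribute [local instance] LieRing.ofAssociativeRing

/-! ### The Poincaré–Birkhoff–Witt representation on ordered monomials -/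

section OrderedMonomials

variable {F L I : Type*} [Field F] [LieRing L] [LieAlgebra F L]

variable (F I) in
/-- Combinations of monomials of degree at most `d`. -/
def degreeLE (d : ℕ) : Submodule F (Multiset I →₀ F) := Finsupp.supported F F {S | S.card ≤ d}

theorem single_mem_degreeLE {d : ℕ} {T : Multiset I} (h : T.card ≤ d) :
    (Finsupp.single T 1 : Multiset I →₀ F) ∈ degreeLE F I d :=
  Finsupp.single_mem_supported F 1 h

theorem degreeLE_mono {d e : ℕ} (h : d ≤ e) : degreeLE F I d ≤ degreeLE F I e :=
  Finsupp.supported_mono fun _ hS => le_trans hS h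

theorem apply_mem_of_basis_single (b : Module.Basis I F L) {W : Type*} [AddCommGroup W] [Module F W]
    (A : L →ₗ[F] (Multiset I →₀ F) →ₗ[F] W) (s : Set (Multiset I)) (P : Submodule F W)
    (h : ∀ i, ∀ T ∈ s, A (b i) (Finsupp.single T 1) ∈ P) (x : L)
    {v : Multiset I →₀ F} (hv : v ∈ Finsupp.supported F F s) : A x v ∈ P := by
  rw [Finsupp.supported_eq_span_single] at hv
  induction hv using Submodule.span_induction with
  | mem v hv =>
    obtain ⟨T, hT, rfl⟩ := hv
    have hx : x ∈ Submodule.span F (Set.range b) := b.span_eq ▸ Submodule.mem_top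
    induction hx using Submodule.span_induction with
    | mem y hy =>
      obtain ⟨i, rfl⟩ := hy
      exact h i T hT
    | zero => simp
    | add y z _ _ hy hz => simpa using P.add_mem hy hz
    | smul c y _ hy => simpa using P.smul_mem c hy
  | zero => simp
  | add y z _ _ hy hz => simpa using P.add_mem hy hz
  | smul c y _ hy => simpa using P.smul_mem c hy

theorem apply_eq_of_basis_single (b : Module.Basis I F L) {W : Type*} [AddCommGroup W] [Module F W]
    (A B : L →ₗ[F] (Multiset I →₀ F) →ₗ[F] W) (s : Set (Multiset I))
    (h : ∀ i, ∀ T ∈ s, A (b i) (Finsupp.single T 1) = B (b i) (Finsupp.single T 1)) (x : L)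
    {v : Multiset I →₀ F} (hv : v ∈ Finsupp.supported F F s) : A x v = B x v := by
  have := apply_mem_of_basis_single b (A - B) s ⊥ (fun i T hT => by simp [h i T hT]) x hv
  simpa [sub_eq_zero] using this

/-- The failure of `A : L → End V` to respect brackets. -/
def lieDefect {V : Type*} [AddCommGroup V] [Module F V] (A : L →ₗ[F] V →ₗ[F] V) :
    L →ₗ[F] L →ₗ[F] V →ₗ[F] V :=
  LinearMap.mk₂ F (fun x y => A x ∘ₗ A y - A y ∘ₗ A x - A ⁅x, y⁆)
    (fun x y z => by ext v; simp; abel) (fun c x y => by ext v; simp [smul_sub])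
    (fun x y z => by ext v; simp; abel) (fun c x y => by ext v; simp [smul_sub])

theorem lieDefect_apply {V : Type*} [AddCommGroup V] [Module F V] (A : L →ₗ[F] V →ₗ[F] V)
    (x y : L) (v : V) : lieDefect A x y v = A x (A y v) - A y (A x v) - A ⁅x, y⁆ v := rfl

theorem lieDefect_swap {V : Type*} [AddCommGroup V] [Module F V] (A : L →ₗ[F] V →ₗ[F] V)
    (x y : L) (v : V) : lieDefect A y x v = - lieDefect A x y v := by
  rw [lieDefect_apply, lieDefect_apply, ← lie_skew x y, map_neg,
    LinearMap.neg_apply]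
  abel

theorem lieDefect_eq_zero_of_basis_single (b : Module.Basis I F L)
    (A : L →ₗ[F] (Multiset I →₀ F) →ₗ[F] (Multiset I →₀ F)) (s : Set (Multiset I))
    (h : ∀ i j, ∀ T ∈ s, lieDefect A (b i) (b j) (Finsupp.single T 1) = 0) (x y : L)
    {v : Multiset I →₀ F} (hv : v ∈ Finsupp.supported F F s) : lieDefect A x y v = 0 := by
  refine apply_eq_of_basis_single b (lieDefect A x) 0 s (fun j T hT => ?_) y hv
  exact apply_eq_of_basis_single b ((lieDefect A).flip (b j)) 0 s (fun i T hT => h i j T hT) x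
    (Finsupp.single_mem_supported F 1 hT)

variable [LinearOrder I]

theorem exists_min_of_not_forall_le {i : I} {T : Multiset I} (h : ¬ ∀ j ∈ T, i ≤ j) :
    ∃ j ∈ T, ∀ k ∈ T, j ≤ k := by
  push Not at h
  obtain ⟨j, hj, -⟩ := h
  have hne : T.toFinset.Nonempty := ⟨j, Multiset.mem_toFinset.2 hj⟩
  exact ⟨T.toFinset.min' hne, Multiset.mem_toFinset.1 (Finset.min'_mem _ _),
    fun k hk => Finset.min'_le _ _ (Multiset.mem_toFinset.2 hk)⟩

/-- The prescribed value of `b i` on the ordered monomial `T`, in terms of an approximation `A`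
of the action on monomials of smaller degree. -/
noncomputable def monomialStep (b : Module.Basis I F L)
    (A : L →ₗ[F] (Multiset I →₀ F) →ₗ[F] (Multiset I →₀ F)) (i : I) (T : Multiset I) :
    Multiset I →₀ F :=
  open Classical in
  if h : ∀ j ∈ T, i ≤ j then Finsupp.single (i ::ₘ T) 1
  else
    -- With `T = j ::ₘ T'` and `j` minimal, this is forced by `b i b j T' = b j b i T' + ⁅b i, b j⁆
    -- T'`: the leading part `i ::ₘ T'` of `b i T'` is multiplied by `j` freely, so `A` only meets
    -- vectors of degree at most that of `T'`.
    Finsupp.single (i ::ₘ T) 1 +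
      A (b (exists_min_of_not_forall_le h).choose)
        (A (b i) (Finsupp.single (T.erase (exists_min_of_not_forall_le h).choose) 1) -
          Finsupp.single (i ::ₘ T.erase (exists_min_of_not_forall_le h).choose) 1) +
      A ⁅b i, b (exists_min_of_not_forall_le h).choose⁆
        (Finsupp.single (T.erase (exists_min_of_not_forall_le h).choose) 1)

theorem monomialStep_of_le (b : Module.Basis I F L)
    (A : L →ₗ[F] (Multiset I →₀ F) →ₗ[F] (Multiset I →₀ F)) {i : I} {T : Multiset I}
    (h : ∀ j ∈ T, i ≤ j) : monomialStep b A i T = Finsupp.single (i ::ₘ T) 1 := by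
  rw [monomialStep, dif_pos h]

theorem monomialStep_cons (b : Module.Basis I F L)
    (A : L →ₗ[F] (Multiset I →₀ F) →ₗ[F] (Multiset I →₀ F)) {i j : I} {T : Multiset I}
    (hij : j < i) (hj : ∀ k ∈ T, j ≤ k) :
    monomialStep b A i (j ::ₘ T) = Finsupp.single (i ::ₘ j ::ₘ T) 1 +
      A (b j) (A (b i) (Finsupp.single T 1) - Finsupp.single (i ::ₘ T) 1) +
      A ⁅b i, b j⁆ (Finsupp.single T 1) := by
  have h : ¬ ∀ k ∈ j ::ₘ T, i ≤ k := fun h => (h j (Multiset.mem_cons_self j T)).not_gt hij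
  have hc := (exists_min_of_not_forall_le h).choose_spec
  have e : (exists_min_of_not_forall_le h).choose = j := by
    refine le_antisymm (hc.2 j (Multiset.mem_cons_self j T)) ?_
    rcases Multiset.mem_cons.1 hc.1 with h' | h'
    · exact h'.ge
    · exact hj _ h'
  rw [monomialStep, dif_neg h, e, Multiset.erase_cons_head]

/-- Successive approximations of the action of `L` on ordered monomials: the `n`-th one is correct
on monomials of degree less than `n`. -/
noncomputable def monomialApprox (b : Module.Basis I F L) :
    ℕ → L →ₗ[F] (Multiset I →₀ F) →ₗ[F] (Multiset I →₀ F)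
  | 0 => 0
  | n + 1 => b.constr F fun i => Finsupp.linearCombination F (monomialStep b (monomialApprox b n) i)

theorem monomialApprox_succ (b : Module.Basis I F L) (n : ℕ) (i : I) (T : Multiset I) :
    monomialApprox b (n + 1) (b i) (Finsupp.single T 1) =
      monomialStep b (monomialApprox b n) i T := by
  simp [monomialApprox, Module.Basis.constr_basis]

/-- The action of `L` on ordered monomials. -/
noncomputable def monomialAct (b : Module.Basis I F L) :
    L →ₗ[F] (Multiset I →₀ F) →ₗ[F] (Multiset I →₀ F) :=
  b.constr F fun i => Finsupp.linearCombination F fun T =>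
    monomialApprox b (T.card + 1) (b i) (Finsupp.single T 1)

/-- The action is multiplication up to terms of no higher degree than `T`. This keeps the
corrections in `monomialStep` within the range where the previous approximation is already correct.
-/
theorem monomialApprox_sub_single_mem (b : Module.Basis I F L) (n : ℕ) :
    ∀ (i : I) (T : Multiset I), T.card < n →
      monomialApprox b n (b i) (Finsupp.single T 1) - Finsupp.single (i ::ₘ T) 1 ∈
        degreeLE F I T.card := by
  induction n with
  | zero => intro i T h; omega
  | succ n ih =>
    have raise : ∀ (d : ℕ), d < n → ∀ (x : L) (v : Multiset I →₀ F), v ∈ degreeLE F I d →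
        monomialApprox b n x v ∈ degreeLE F I (d + 1) := by
      intro d hd x v hv
      refine apply_mem_of_basis_single b _ {S | S.card ≤ d} _ (fun i T hT => ?_) x hv
      have hT : T.card ≤ d := hT
      have h := (degreeLE F I (d + 1)).add_mem
        (degreeLE_mono (by omega) (ih i T (by omega)))
        (single_mem_degreeLE (T := i ::ₘ T) (by simpa using hT))
      rwa [sub_add_cancel] at h
    intro i T hT
    rw [monomialApprox_succ]
    by_cases h : ∀ j ∈ T, i ≤ j
    · rw [monomialStep_of_le b _ h, sub_self]
      exact zero_mem _
    · obtain ⟨j, hj, hmin⟩ := exists_min_of_not_forall_le h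
      obtain ⟨T, rfl⟩ := Multiset.exists_cons_of_mem hj
      have hij : j < i := by
        by_contra hji
        exact h fun k hk => (not_lt.1 hji).trans (hmin k hk)
      rw [Multiset.card_cons] at hT ⊢
      rw [monomialStep_cons b _ hij fun k hk => hmin k (Multiset.mem_cons_of_mem hk), add_assoc,
        add_sub_cancel_left]
      exact add_mem (raise _ (by omega) _ _ (ih i T (by omega)))
        (raise _ (by omega) _ _ (single_mem_degreeLE le_rfl))

/-- The two recursion steps differ only in the approximations they call, and those agree by
induction because they are called in smaller degree. -/
theorem monomialApprox_succ_eq (b : Module.Basis I F L) (n : ℕ) (x : L) {d : ℕ} (hd : d < n)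
    {v : Multiset I →₀ F} (hv : v ∈ degreeLE F I d) :
    monomialApprox b (n + 1) x v = monomialApprox b n x v := by
  induction n generalizing x d v with
  | zero => omega
  | succ n ih =>
    refine apply_eq_of_basis_single b _ _ {S | S.card ≤ d} (fun i T hT => ?_) x hv
    have hT : T.card ≤ d := hT
    rw [monomialApprox_succ, monomialApprox_succ]
    by_cases h : ∀ j ∈ T, i ≤ j
    · rw [monomialStep_of_le b _ h, monomialStep_of_le b _ h]
    · obtain ⟨j, hj, hmin⟩ := exists_min_of_not_forall_le h
      obtain ⟨T, rfl⟩ := Multiset.exists_cons_of_mem hj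
      have hij : j < i := by
        by_contra hji
        exact h fun k hk => (not_lt.1 hji).trans (hmin k hk)
      rw [Multiset.card_cons] at hT
      have hmin' : ∀ k ∈ T, j ≤ k := fun k hk => hmin k (Multiset.mem_cons_of_mem hk)
      have hT' : T.card < n := by omega
      rw [monomialStep_cons b _ hij hmin', monomialStep_cons b _ hij hmin',
        ih _ hT' (single_mem_degreeLE le_rfl), ih _ hT' (single_mem_degreeLE le_rfl),
        ih _ hT' (monomialApprox_sub_single_mem b n i T hT')]

theorem monomialApprox_eq_of_le (b : Module.Basis I F L) {n m : ℕ} (hnm : n ≤ m) (x : L) {d : ℕ}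
    (hd : d < n) {v : Multiset I →₀ F} (hv : v ∈ degreeLE F I d) :
    monomialApprox b m x v = monomialApprox b n x v := by
  induction m, hnm using Nat.le_induction with
  | base => rfl
  | succ m hm ih => rw [monomialApprox_succ_eq b m x (by omega) hv, ih]

theorem monomialAct_basis_single (b : Module.Basis I F L) (i : I) (T : Multiset I) :
    monomialAct b (b i) (Finsupp.single T 1) =
      monomialApprox b (T.card + 1) (b i) (Finsupp.single T 1) := by
  simp [monomialAct, Module.Basis.constr_basis]

theorem monomialAct_eq_approx (b : Module.Basis I F L) {n : ℕ} (x : L) {d : ℕ}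
    (hd : d < n) {v : Multiset I →₀ F} (hv : v ∈ degreeLE F I d) :
    monomialAct b x v = monomialApprox b n x v := by
  refine apply_eq_of_basis_single b _ _ {S | S.card ≤ d} (fun i T hT => ?_) x hv
  have hT : T.card ≤ d := hT
  rw [monomialAct_basis_single]
  exact (monomialApprox_eq_of_le b (by omega) (b i) (Nat.lt_succ_self _)
    (single_mem_degreeLE le_rfl)).symm

theorem monomialAct_sub_single_mem (b : Module.Basis I F L) (i : I) (T : Multiset I) :
    monomialAct b (b i) (Finsupp.single T 1) - Finsupp.single (i ::ₘ T) 1 ∈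
      degreeLE F I T.card := by
  rw [monomialAct_basis_single]
  exact monomialApprox_sub_single_mem b _ i T (Nat.lt_succ_self _)

theorem monomialAct_of_le (b : Module.Basis I F L) {i : I} {T : Multiset I}
    (h : ∀ j ∈ T, i ≤ j) :
    monomialAct b (b i) (Finsupp.single T 1) = Finsupp.single (i ::ₘ T) 1 := by
  rw [monomialAct_basis_single, monomialApprox_succ, monomialStep_of_le b _ h]

/-- The stable form of `monomialStep_cons`: since `j` is minimal, the leading monomial is itself `b
j` applied to `i ::ₘ T` and is absorbed in the first term. -/
theorem monomialAct_cons (b : Module.Basis I F L) {i j : I} {T : Multiset I}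
    (hij : j < i) (hj : ∀ k ∈ T, j ≤ k) :
    monomialAct b (b i) (Finsupp.single (j ::ₘ T) 1) =
      monomialAct b (b j) (monomialAct b (b i) (Finsupp.single T 1)) +
        monomialAct b ⁅b i, b j⁆ (Finsupp.single T 1) := by
  have hlt := Nat.lt_succ_self T.card
  have h1 := monomialAct_eq_approx b ⁅b i, b j⁆ hlt (single_mem_degreeLE (F := F) le_rfl)
  have h2 := monomialAct_eq_approx b (b j) hlt (monomialAct_sub_single_mem b i T)
  have h3 := monomialAct_eq_approx b (b i) hlt (single_mem_degreeLE (F := F) le_rfl)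
  have h4 : monomialAct b (b j) (Finsupp.single (i ::ₘ T) 1) =
      Finsupp.single (i ::ₘ j ::ₘ T) 1 := by
    rw [monomialAct_of_le, Multiset.cons_swap]
    intro k hk
    rcases Multiset.mem_cons.1 hk with rfl | hk
    · exact hij.le
    · exact hj k hk
  rw [monomialAct_basis_single, monomialApprox_succ, monomialStep_cons b _ hij hj,
    Multiset.card_cons, ← h1, ← h3, ← h2, map_sub, h4]
  abel

/-- Every term of the recursion is a nonempty monomial or again a value of the action, so constant
terms never arise. -/
theorem monomialAct_mem_supported_ne_zero (b : Module.Basis I F L) (x : L)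
    (v : Multiset I →₀ F) : monomialAct b x v ∈ Finsupp.supported F F {S : Multiset I | S ≠ 0} := by
  have key : ∀ n x (v : Multiset I →₀ F),
      monomialApprox b n x v ∈ Finsupp.supported F F {S : Multiset I | S ≠ 0} := by
    intro n
    induction n with
    | zero => intro x v; exact zero_mem _
    | succ n ih =>
      intro x v
      refine apply_mem_of_basis_single b _ Set.univ _ (fun i T _ => ?_) x (by simp)
      have hs : Finsupp.single (i ::ₘ T) (1 : F) ∈
          Finsupp.supported F F {S : Multiset I | S ≠ 0} :=
        Finsupp.single_mem_supported F 1 (Multiset.cons_ne_zero)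
      rw [monomialApprox_succ, monomialStep]
      split_ifs with h
      · exact hs
      · exact add_mem (add_mem hs (ih _ _)) (ih _ _)
  refine apply_mem_of_basis_single b _ Set.univ _ (fun i T _ => ?_) x (by simp)
  rw [monomialAct_basis_single]
  exact key _ _ _

theorem lieDefect_monomialAct_of_le (b : Module.Basis I F L) {i j : I} {T : Multiset I}
    (hij : j < i) (hj : ∀ k ∈ T, j ≤ k) :
    lieDefect (monomialAct b) (b i) (b j) (Finsupp.single T 1) = 0 := by
  rw [lieDefect_apply, monomialAct_of_le b hj, monomialAct_cons b hij hj]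
  abel

/-- Induction on degree. If `i` or `j` is at most every index in `T`, the recursion gives the claim.
Otherwise the least index `k` of `T` is below both; then `T` is `b k` applied to a shorter monomial,
and the Jacobi identity reduces the claim to known cases. -/
theorem lieDefect_monomialAct_single (b : Module.Basis I F L) (n : ℕ) :
    ∀ T : Multiset I, T.card < n → ∀ i j,
      lieDefect (monomialAct b) (b i) (b j) (Finsupp.single T 1) = 0 := by
  induction n with
  | zero => intro T h; omega
  | succ n ih =>
    have ih' : ∀ d < n, ∀ (x y : L) (v : Multiset I →₀ F), v ∈ degreeLE F I d →
        lieDefect (monomialAct b) x y v = 0 := fun d hd x y v hv =>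
      lieDefect_eq_zero_of_basis_single b _ {S | S.card ≤ d}
        (fun i j T hT => ih T (lt_of_le_of_lt hT hd) i j) x y hv
    intro T hT i j
    wlog hij : j < i generalizing i j
    · rcases (not_lt.1 hij).eq_or_lt with rfl | h
      · simp [lieDefect_apply]
      · rw [lieDefect_swap, this j i h, neg_zero]
    by_cases hj : ∀ k ∈ T, j ≤ k
    · exact lieDefect_monomialAct_of_le b hij hj
    obtain ⟨k, hk, hmin⟩ := exists_min_of_not_forall_le hj
    have hkj : k < j := by
      by_contra hkj
      exact hj fun l hl => (not_lt.1 hkj).trans (hmin l hl)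
    obtain ⟨T, rfl⟩ := Multiset.exists_cons_of_mem hk
    rw [Multiset.card_cons] at hT
    have hT' : T.card < n := by omega
    have hmin' : ∀ l ∈ T, k ≤ l := fun l hl => hmin l (Multiset.mem_cons_of_mem hl)
    -- `b q T` has the same degree as the original monomial, so induction covers only its lower
    -- terms; its leading monomial `q ::ₘ T` is covered because `k` is minimal there.
    have direct : ∀ p q : I, k < p → k < q → lieDefect (monomialAct b) (b p) (b k)
        (monomialAct b (b q) (Finsupp.single T 1)) = 0 := by
      intro p q hp hq
      rw [← sub_add_cancel (monomialAct b (b q) (Finsupp.single T 1))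
        (Finsupp.single (q ::ₘ T) 1), map_add,
        ih' _ hT' _ _ _ (monomialAct_sub_single_mem b q T), lieDefect_monomialAct_of_le b hp,
        zero_add]
      intro l hl
      rcases Multiset.mem_cons.1 hl with rfl | hl
      · exact hq.le
      · exact hmin' l hl
    have hs := fun x y => ih' _ hT' x y _ (single_mem_degreeLE (F := F) (T := T) le_rfl)
    have h1 := hs (b j) (b k)
    have h1' := hs (b i) (b k)
    have h2 := direct i j (hkj.trans hij) hkj
    have h2' := direct j i hkj (hkj.trans hij)
    have h3 := hs (b i) ⁅b j, b k⁆
    have h3' := hs (b j) ⁅b i, b k⁆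
    have h4 := congrArg (monomialAct b (b k)) (hs (b i) (b j))
    have h5 := hs ⁅b i, b j⁆ (b k)
    have jac : ⁅⁅b i, b j⁆, b k⁆ = ⁅b i, ⁅b j, b k⁆⁆ - ⁅b j, ⁅b i, b k⁆⁆ := lie_lie _ _ _
    have g1 := congrArg (monomialAct b (b i)) h1
    have g1' := congrArg (monomialAct b (b j)) h1'
    -- Now every term is a word in the action applied to the shorter `T`, and the known vanishing
    -- defects combine linearly to the goal.
    rw [← monomialAct_of_le b hmin', lieDefect_apply]
    simp only [lieDefect_apply, jac, map_sub, LinearMap.sub_apply, map_zero] at *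
    linear_combination (norm := module) g1 - g1' + h2 - h2' + h3 - h3' + h4 - h5

/-- The representation of `L` on ordered monomials. -/
noncomputable def monomialRep (b : Module.Basis I F L) :
    L →ₗ⁅F⁆ Module.End F (Multiset I →₀ F) where
  __ := monomialAct b
  map_lie' := by
    intro x y
    ext1 v
    refine LinearMap.ext fun c => ?_
    have h := lieDefect_eq_zero_of_basis_single b (monomialAct b) Set.univ
      (fun i j T _ => lieDefect_monomialAct_single b _ T (Nat.lt_succ_self _) i j) x y
      (v := Finsupp.single v c) (by simp)
    rw [lieDefect_apply, sub_eq_zero] at h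
    exact h.symm

theorem monomialRep_apply (b : Module.Basis I F L) (x : L) :
    monomialRep b x = monomialAct b x := rfl

/-- Initial basis vectors that commute with one another act by multiplication. -/
theorem monomialAct_of_commute (b : Module.Basis I F L) {s : Set I} (hs : IsLowerSet s)
    (hcomm : ∀ i ∈ s, ∀ j ∈ s, ⁅b i, b j⁆ = 0) {i : I} (hi : i ∈ s) (T : Multiset I) :
    monomialAct b (b i) (Finsupp.single T 1) = Finsupp.single (i ::ₘ T) 1 := by
  induction hn : T.card generalizing T with
  | zero =>
    rw [Multiset.card_eq_zero] at hn
    subst hn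
    exact monomialAct_of_le b (by simp)
  | succ n ih =>
    by_cases h : ∀ j ∈ T, i ≤ j
    · exact monomialAct_of_le b h
    · obtain ⟨j, hj, hmin⟩ := exists_min_of_not_forall_le h
      have hij : j < i := by
        by_contra hji
        exact h fun k hk => (not_lt.1 hji).trans (hmin k hk)
      obtain ⟨T, rfl⟩ := Multiset.exists_cons_of_mem hj
      rw [Multiset.card_cons] at hn
      rw [monomialAct_cons b hij fun k hk => hmin k (Multiset.mem_cons_of_mem hk),
        hcomm i hi j (hs hij.le hi), ih T (by omega), map_zero, LinearMap.zero_apply, add_zero,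
        Multiset.cons_swap]
      refine monomialAct_of_le b fun k hk => ?_
      rcases Multiset.mem_cons.1 hk with rfl | hk
      · exact hij.le
      · exact hmin k (Multiset.mem_cons_of_mem hk)

end OrderedMonomials

/-! ### The embedding of `M` in `U(L) / M ω(L)` and the ideal `𝔍` -/

section

variable {F L : Type*} [Field F] [LieRing L] [LieAlgebra F L]

/-- `L` creates no constant terms, so `U(L)` acts on them through the augmentation. In particular
`ω(L)` maps into vectors without constant term. -/
theorem lift_monomialRep_apply_zero {I : Type*} [LinearOrder I] (b : Module.Basis I F L)
    (u : UniversalEnvelopingAlgebra F L) (v : Multiset I →₀ F) :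
    (UniversalEnvelopingAlgebra.lift F (monomialRep b) u v) 0 = augmentation F u * v 0 := by
  have hu : u ∈ Algebra.adjoin F (Set.range (UniversalEnvelopingAlgebra.ι F : L → _)) := by
    rw [adjoin_range_ι]; trivial
  induction hu using Algebra.adjoin_induction generalizing v with
  | mem y hy =>
    obtain ⟨x, rfl⟩ := hy
    rw [UniversalEnvelopingAlgebra.lift_ι_apply, augmentation,
      UniversalEnvelopingAlgebra.lift_ι_apply, LieHom.zero_apply, zero_mul, monomialRep_apply]
    by_contra h
    exact (Finsupp.mem_supported F _).1 (monomialAct_mem_supported_ne_zero b x v)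
      (Finsupp.mem_support_iff.2 h) rfl
  | algebraMap r => simp [Module.algebraMap_end_apply]
  | add y z _ _ hy hz => simp [hy, hz, add_mul]
  | mul y z _ _ hy hz => simp [hy, hz, mul_assoc]

theorem monomialAct_single_zero_apply {I : Type*} [LinearOrder I] (b : Module.Basis I F L)
    (x : L) (i : I) : monomialAct b x (Finsupp.single 0 1) {i} = b.repr x i := by
  have h : (Finsupp.lapply {i}) ∘ₗ (monomialAct b).flip (Finsupp.single 0 1) = b.coord i := by
    refine b.ext fun j => ?_
    have hj : monomialAct b (b j) (Finsupp.single 0 1) = Finsupp.single {j} 1 :=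
      monomialAct_of_le b (by simp)
    simp [hj, Finsupp.single_apply]
  exact LinearMap.congr_fun h x

/-- A finite-dimensional space has an ordered basis that begins with a basis of a given subspace. -/
theorem exists_basis_adapted [FiniteDimensional F L] (M : Submodule F L) :
    ∃ (n : ℕ) (b : Module.Basis (Fin n) F L) (s : Set (Fin n)), IsLowerSet s ∧
      (∀ i ∈ s, b i ∈ M) ∧ M ≤ Submodule.span F (b '' s) := by
  obtain ⟨N, hN⟩ := M.exists_isCompl
  let c := (((Module.finBasis F M).prod (Module.finBasis F N)).map
    (M.prodEquivOfIsCompl N hN)).reindex finSumFinEquiv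
  have hc : ∀ i, c (Fin.castAdd _ i) = Module.finBasis F M i := by
    intro i
    simp [c, Module.Basis.prod_apply]
  refine ⟨_, c, Set.range (Fin.castAdd _), ?_, ?_, ?_⟩
  · rintro _ j hj ⟨i, rfl⟩
    exact ⟨⟨j, lt_of_le_of_lt (Fin.le_def.1 hj) i.2⟩, rfl⟩
  · rintro _ ⟨i, rfl⟩
    rw [hc]
    exact (Module.finBasis F M i).2
  · intro m hm
    have h := congrArg Subtype.val ((Module.finBasis F M).sum_repr ⟨m, hm⟩)
    change _ = m at h
    rw [← h, AddSubmonoidClass.coe_finsetSum]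
    refine Submodule.sum_mem _ fun i _ => Submodule.smul_mem _ _ (Submodule.subset_span ?_)
    exact ⟨_, ⟨i, rfl⟩, hc i⟩

/-- `L` embeds in `U(L) / M ω(L)`. -/
theorem eq_zero_of_ι_mem_Mω [FiniteDimensional F L] (M : LieIdeal F L) [IsLieAbelian M] {m : L}
    (h : UniversalEnvelopingAlgebra.ι F m ∈ Mω M) : m = 0 := by
  obtain ⟨n, b, s, hs, hbM, hMs⟩ := exists_basis_adapted M.toSubmodule
  have hcomm : ∀ i ∈ s, ∀ j ∈ s, ⁅b i, b j⁆ = 0 := fun i hi j hj =>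
    congrArg Subtype.val (LieModule.IsTrivial.trivial (⟨b i, hbM i hi⟩ : M) (⟨b j, hbM j hj⟩ : M))
  -- Basis vectors of the abelian ideal `M` come first and commute, so they multiply monomials
  -- freely and raise the degree by one.
  have hdeg : ∀ y ∈ M, ∀ v ∈ Finsupp.supported F F {S : Multiset (Fin n) | S ≠ 0},
      monomialAct b y v ∈ Finsupp.supported F F {S : Multiset (Fin n) | 1 < S.card} := by
    intro y hy v hv
    have hys : y ∈ Submodule.span F (b '' s) := hMs hy
    clear hy
    induction hys using Submodule.span_induction with
    | mem y hy =>
      obtain ⟨i, hi, rfl⟩ := hy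
      rw [Finsupp.supported_eq_span_single] at hv
      induction hv using Submodule.span_induction with
      | mem v hv =>
        obtain ⟨T, hT, rfl⟩ := hv
        have hT : T ≠ 0 := hT
        simp only [monomialAct_of_commute b hs hcomm hi]
        refine Finsupp.single_mem_supported F 1 ?_
        simpa [Multiset.card_pos] using hT
      | zero => simp
      | add y z _ _ hy hz => simpa using add_mem hy hz
      | smul c y _ hy => simpa using Submodule.smul_mem _ c hy
    | zero => simp
    | add y z _ _ hy hz => simpa using add_mem hy hz
    | smul c y _ hy => simpa using Submodule.smul_mem _ c hy
  have key : ∀ a ∈ Mω M, UniversalEnvelopingAlgebra.lift F (monomialRep b) a (Finsupp.single 0 1) ∈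
      Finsupp.supported F F {S : Multiset (Fin n) | 1 < S.card} := by
    intro a ha
    induction ha using Submodule.mul_induction_on' with
    | mem_mul_mem y hy u hu =>
      obtain ⟨y, hy, rfl⟩ := hy
      have e : UniversalEnvelopingAlgebra.lift F (monomialRep b)
          (UniversalEnvelopingAlgebra.ι F y) = monomialAct b y :=
        UniversalEnvelopingAlgebra.lift_ι_apply F _ y
      rw [map_mul, Module.End.mul_apply]
      refine (congrArg (· ∈ _) (LinearMap.congr_fun e _)).mpr (hdeg y hy _ ?_)
      rw [Finsupp.mem_supported]
      rintro S hS rfl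
      refine Finsupp.mem_support_iff.1 hS ?_
      rw [lift_monomialRep_apply_zero, (mem_augIdeal u).1 hu, zero_mul]
    | add y _ z _ hy hz => simpa using add_mem hy hz
  have hm' := key _ h
  rw [UniversalEnvelopingAlgebra.lift_ι_apply, monomialRep_apply] at hm'
  -- The coordinates of `m` are the degree-one coefficients of `m` acting on `1`, and these vanish
  -- by `hm'`.
  refine b.ext_elem fun i => ?_
  rw [← monomialAct_single_zero_apply, map_zero, Finsupp.zero_apply]
  by_contra hne
  have : 1 < Multiset.card {i} := (Finsupp.mem_supported F _).1 hm' (Finsupp.mem_support_iff.2 hne)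
  simp at this

/-- The action of `U(L)` on the ideal `M` that extends the adjoint one. -/
noncomputable def adRep (M : LieIdeal F L) :
    UniversalEnvelopingAlgebra F L →ₐ[F] Module.End F M :=
  UniversalEnvelopingAlgebra.lift F (LieModule.toEnd F L M)

theorem adRep_ι (M : LieIdeal F L) (x : L) :
    adRep M (UniversalEnvelopingAlgebra.ι F x) = LieModule.toEnd F L M x :=
  UniversalEnvelopingAlgebra.lift_ι_apply F _ x

theorem ι_mem_MU (M : LieIdeal F L) (m : M) :
    UniversalEnvelopingAlgebra.ι F (m : L) ∈ MU M := by
  have h : UniversalEnvelopingAlgebra.ι F (m : L) * 1 ∈ MU M :=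
    Submodule.mul_mem_mul ⟨m, m.2, rfl⟩ Submodule.mem_top
  rwa [mul_one] at h

theorem ι_mem_augIdeal (x : L) : UniversalEnvelopingAlgebra.ι F x ∈ augIdeal F L := by
  rw [mem_augIdeal, augmentation, UniversalEnvelopingAlgebra.lift_ι_apply, LieHom.zero_apply]

/-- Modulo `M ω(L)`, left multiplication by `w` on `M` is the adjoint action. -/
theorem mul_ι_sub_mem_Mω (M : LieIdeal F L) (w : UniversalEnvelopingAlgebra F L) (m : M) :
    w * UniversalEnvelopingAlgebra.ι F (m : L) -
      UniversalEnvelopingAlgebra.ι F (adRep M w m : L) ∈ Mω M := by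
  have hw : w ∈ Algebra.adjoin F (Set.range (UniversalEnvelopingAlgebra.ι F : L → _)) := by
    rw [adjoin_range_ι]; trivial
  induction hw using Algebra.adjoin_induction generalizing m with
  | mem y hy =>
    obtain ⟨x, rfl⟩ := hy
    -- As `m x` vanishes modulo `M ω(L)`, `x m` is congruent to the commutator.
    have h : UniversalEnvelopingAlgebra.ι F (m : L) * UniversalEnvelopingAlgebra.ι F x ∈ Mω M :=
      Submodule.mul_mem_mul ⟨m, m.2, rfl⟩ (ι_mem_augIdeal x)
    rw [adRep_ι, LieModule.toEnd_apply_apply, LieSubmodule.coe_bracket, LieHom.map_lie,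
      LieRing.of_associative_ring_bracket]
    simpa using h
  | algebraMap r => simp [Module.algebraMap_end_apply, ← Algebra.smul_def]
  | add y z _ _ hy hz =>
    convert add_mem (hy m) (hz m) using 1
    simp [add_mul]
    abel
  | mul y z _ _ hy hz =>
    convert add_mem (mul_mem_Mω M y (hz m)) (hy (adRep M z m)) using 1
    simp [mul_sub, mul_assoc]

/-- For `w ∈ ω(L)` the term `a w` is negligible, and `w a ∈ M ω(L)` needs checking only for `a ∈ M`,
where it says that the adjoint image lies in `M ω(L)`, hence is zero. -/
theorem mem_frakJ_iff [FiniteDimensional F L] (M : LieIdeal F L) [IsLieAbelian M]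
    (w : UniversalEnvelopingAlgebra F L) :
    w ∈ frakJ M ↔ augmentation F w = 0 ∧ adRep M w = 0 := by
  rw [mem_frakJ, mem_augIdeal, and_comm]
  refine and_congr_right fun hw => ⟨fun h => LinearMap.ext fun m => Subtype.ext ?_, fun h a ha => ?_⟩
  · refine eq_zero_of_ι_mem_Mω M ?_
    have h1 := h _ (ι_mem_MU M m)
    have h2 := MU_mul_aug_mem M (ι_mem_MU M m) hw
    have h3 := mul_ι_sub_mem_Mω M w m
    convert sub_mem (add_mem h1 h2) h3 using 1
    abel
  · refine sub_mem ?_ (MU_mul_aug_mem M ha hw)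
    induction ha using Submodule.mul_induction_on' with
    | mem_mul_mem y hy u hu =>
      obtain ⟨m, hm, rfl⟩ := hy
      have h1 := mul_ι_sub_mem_Mω M w ⟨m, hm⟩
      rw [h] at h1
      rw [← mul_assoc]
      refine Mω_mul_mem M u ?_
      simpa using h1
    | add y _ z _ hy hz => simpa [mul_add] using add_mem hy hz

end

/-! ### Polynomials of smallest degree -/

section SmallestDegree

variable {F V : Type*} [Field F] [AddCommGroup V] [Module F V]

/-- The remainder of `g` modulo `f` satisfies both vanishing conditions and has smaller degree, so
it is zero. -/
theorem dvd_of_isSmallestDegree {φ : Module.End F V} {f g : F[X]} (hf : IsSmallestDegree φ f)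
    (h0 : g.eval 0 = 0) (hφ : aeval φ g = 0) : f ∣ g := by
  obtain ⟨hf, hf0, hfφ, hmin⟩ := hf
  rw [← EuclideanDomain.mod_eq_zero]
  by_contra hr
  have e : g % f = g - f * (g / f) := by rw [EuclideanDomain.mod_eq_sub_mul_div]
  have h := hmin (g % f) hr (by rw [e]; simp [h0, hf0]) (by rw [e]; simp [hφ, hfφ])
  exact absurd (natDegree_lt_natDegree hr (degree_mod_lt g hf)) h.not_gt

theorem existsUnique_monic_isSmallestDegree [FiniteDimensional F V] (φ : Module.End F V) :
    ∃! f : F[X], f.Monic ∧ IsSmallestDegree φ f := by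
  have hex : ∃ n, ∃ f : F[X], f ≠ 0 ∧ f.eval 0 = 0 ∧ aeval φ f = 0 ∧ f.natDegree = n :=
    -- The factor `X` enforces vanishing at 0, which the minimal polynomial need not have.
    ⟨_, X * minpoly F φ, mul_ne_zero X_ne_zero (minpoly.ne_zero (Algebra.IsIntegral.isIntegral φ)),
      by simp, by simp, rfl⟩
  classical
  obtain ⟨f, hf, hf0, hfφ, hn⟩ := Nat.find_spec hex
  have hc : C f.leadingCoeff⁻¹ ≠ 0 := C_ne_zero.2 (inv_ne_zero (leadingCoeff_ne_zero.2 hf))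
  have hs : IsSmallestDegree φ (f * C f.leadingCoeff⁻¹) := by
    refine ⟨mul_ne_zero hf hc, by simp [hf0], by rw [map_mul, hfφ, zero_mul],
      fun g hg hg0 hgφ => ?_⟩
    rw [natDegree_mul hf hc, natDegree_C, add_zero, hn]
    exact Nat.find_min' hex ⟨g, hg, hg0, hgφ, rfl⟩
  refine ⟨_, ⟨monic_mul_leadingCoeff_inv hf, hs⟩, fun g hg => ?_⟩
  exact eq_of_monic_of_associated hg.1 (monic_mul_leadingCoeff_inv hf)
    (associated_of_dvd_dvd (dvd_of_isSmallestDegree hg.2 hs.2.1 hs.2.2.1)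
      (dvd_of_isSmallestDegree hs hg.2.2.1 hg.2.2.2.1))

end SmallestDegree

/-! ### The presentation of `U_M` by one generator -/

section

variable {F L : Type*} [Field F] [LieRing L] [LieAlgebra F L]

theorem aeval_toAssocU (M : LieIdeal F L) (x : L) (p : F[X]) :
    aeval (toAssocU M x) p =
      Ideal.Quotient.mk (frakJ M) (aeval (UniversalEnvelopingAlgebra.ι F x) p) :=
  aeval_algHom_apply (Ideal.Quotient.mkₐ F (frakJ M)) _ p

/-- The augmentation sends `x` to 0 and `adRep M` sends it to `ad x`, so the two conditions defining
`𝔍` become these. -/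
theorem aeval_toAssocU_eq_zero_iff [FiniteDimensional F L] (M : LieIdeal F L) [IsLieAbelian M]
    (x : L) (p : F[X]) : aeval (toAssocU M x) p = 0 ↔
      p.eval 0 = 0 ∧ aeval (LieModule.toEnd F L M x) p = 0 := by
  rw [aeval_toAssocU, Ideal.Quotient.eq_zero_iff_mem, mem_frakJ_iff, ← aeval_algHom_apply,
    ← aeval_algHom_apply, adRep_ι, (mem_augIdeal _).1 (ι_mem_augIdeal x), coe_aeval_eq_eval]

theorem aeval_toAssocU_surjective [FiniteDimensional F L] (M : LieIdeal F L) [IsLieAbelian M]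
    (x : L) (hx : Codisjoint (centralizer M).toSubmodule (Submodule.span F {x})) :
    Function.Surjective (aeval (R := F) (toAssocU M x)) := by
  have hL : ∀ y : L, toAssocU M y ∈ (aeval (R := F) (toAssocU M x)).range := by
    intro y
    obtain ⟨c, z, hc, hz, rfl⟩ := Submodule.codisjoint_iff_exists_add_eq.1 hx y
    obtain ⟨r, rfl⟩ := Submodule.mem_span_singleton.1 hz
    have h0 : UniversalEnvelopingAlgebra.ι F c ∈ frakJ M := by
      rw [mem_frakJ_iff, adRep_ι]
      -- By definition the centralizer is the kernel of the adjoint action on `M`, so `hc` is the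
      -- required vanishing.
      exact ⟨ι_mem_augIdeal c, hc⟩
    refine ⟨C r * X, ?_⟩
    simp only [AlgHom.toRingHom_eq_coe, RingHom.coe_coe, map_mul, aeval_C, aeval_X]
    rw [← Algebra.smul_def, toAssocU, toAssocU, map_add, map_smul, map_add,
      Ideal.Quotient.eq_zero_iff_mem.2 h0, zero_add]
    rfl
  intro a
  obtain ⟨u, rfl⟩ := Ideal.Quotient.mk_surjective a
  have hu : u ∈ Algebra.adjoin F (Set.range (UniversalEnvelopingAlgebra.ι F : L → _)) := by
    rw [adjoin_range_ι]; trivial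
  have hle : Algebra.adjoin F (Set.range (UniversalEnvelopingAlgebra.ι F : L → _)) ≤
      (aeval (R := F) (toAssocU M x)).range.comap (Ideal.Quotient.mkₐ F (frakJ M)) :=
    Algebra.adjoin_le (by rintro _ ⟨y, rfl⟩; exact hL y)
  exact hle hu

end

end EnvelopingInvariant

theorem mainTheorem9 {F : Type*} {L : Type*} [Field F] [LieRing L] [LieAlgebra F L]
    [FiniteDimensional F L] (M : LieIdeal F L) [IsLieAbelian M] (x : L)
    (hx : IsCompl (EnvelopingInvariant.centralizer M).toSubmodule (Submodule.span F {x})) :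
    (∃! f : Polynomial F, f.Monic ∧
      EnvelopingInvariant.IsSmallestDegree (LieModule.toEnd F L M x) f) ∧
    ∀ f : Polynomial F, EnvelopingInvariant.IsSmallestDegree (LieModule.toEnd F L M x) f →
      ∃ e : EnvelopingInvariant.assocU M ≃ₐ[F] Polynomial F ⧸ Ideal.span {f},
        e (EnvelopingInvariant.toAssocU M x) =
          Ideal.Quotient.mk (Ideal.span {f}) Polynomial.X := by
  -- Uniqueness up to a nonzero scalar is expressed by the monic representative; the isomorphism is
  -- then the inverse of the one induced by evaluation at the class of `x`.
  refine ⟨EnvelopingInvariant.existsUnique_monic_isSmallestDegree _, fun f hf => ?_⟩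
  have hsurj := EnvelopingInvariant.aeval_toAssocU_surjective M x hx.codisjoint
  have hker : Ideal.span {f} =
      RingHom.ker (Polynomial.aeval (R := F) (EnvelopingInvariant.toAssocU M x)) := by
    ext p
    rw [Ideal.mem_span_singleton, RingHom.mem_ker,
      EnvelopingInvariant.aeval_toAssocU_eq_zero_iff]
    constructor
    · rintro ⟨q, rfl⟩
      simp [hf.2.1, hf.2.2.1]
    · exact fun h => EnvelopingInvariant.dvd_of_isSmallestDegree hf h.1 h.2
  refine ⟨((Ideal.quotientEquivAlgOfEq F hker).trans
    (Ideal.quotientKerAlgEquivOfSurjective hsurj)).symm, ?_⟩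
  rw [AlgEquiv.symm_apply_eq]
  simp
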